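/- Let $\mathcal{C}$ be the set of complex-valued continuous functions $a=\{a(t)\}$ on $[0,\infty)$, a commutative ring without identity under pointwise addition and the convolution $ab=\left\{\int_0^t a(t-u)b(u)\,du\right\}$, and let $Q(\mathcal{C})$ be its ring of fractions (Mikusiński's field). Identify $\alpha\in\mathbb{C}$ with $\{\alpha\}/\{1\}\in Q(\mathcal{C})$, and put $l=\{1\}$, $s=1/l$. Let $d/ds$ be the derivation of $Q(\mathcal{C})$ that extends $\{a(t)\}\mapsto\{-t\,a(t)\}$ by the quotient rule, and let $D=-s^2\,\dfrac{d}{ds}$. For a real number $q>0$ let $\tau_q\colon\mathcal{C}\to\mathcal{C}$ be the map $\tau_q\{a(t)\}=\{q\,a(qt)\}$, extended to $Q(\mathcal{C})$ by $\tau_q(a/b)=\tau_q(a)/\tau_q(b)$. Then $Q(\mathcal{C})$ is a field, $\tau_q$ is an automorphism of $Q(\mathcal{C})$ which extends $\tau_q\colon\mathcal{C}\to\mathcal{C}$, and: 1. $\tau_q\alpha=\alpha$ for all $\alpha\in\mathbb{C}$; 2. $\tau_q l=ql$; 3. $\tau_q s=s/q$; 4. $Dl=1$, and $(Q(\mathcal{C}),D,\tau_q)$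 is a DT field, that is, a field with a derivation $D$ (an additive map with $D(xy)=D(x)y+xD(y)$) and a transforming operator $\tau_q$ (an injective ring endomorphism); moreover $D\tau_q=q\,\tau_qD$ and $l\,D\tau_q=\tau_q(l\,D)$, i.e. $D(\tau_q x)=q\,\tau_q(Dx)$ and $l\,D(\tau_q x)=\tau_q(l\,Dx)$ for all $x\in Q(\mathcal{C})$. -/

import Mathlib

open scoped NNReal nonZeroDivisors

namespace Mikusinski

noncomputable section

/-- The set `𝒞` of complex-valued continuous functions on `[0, ∞)`. A type synonym, because the
multiplication of `𝒞` is the convolution and not the pointwise product. -/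
def ContFun : Type := C(ℝ≥0, ℂ)

namespace ContFun

instance : AddCommGroup ContFun := inferInstanceAs (AddCommGroup C(ℝ≥0, ℂ))

instance : Module ℂ ContFun := inferInstanceAs (Module ℂ C(ℝ≥0, ℂ))

instance : FunLike ContFun ℝ≥0 ℂ := inferInstanceAs (FunLike C(ℝ≥0, ℂ) ℝ≥0 ℂ)

/-- The element `{f(t)}` of `𝒞` given by a continuous function `f`. -/
def mk (f : ℝ≥0 → ℂ) (hf : Continuous f) : ContFun := (⟨f, hf⟩ : C(ℝ≥0, ℂ))

theorem continuous_coe (f : ContFun) : Continuous (f : ℝ≥0 → ℂ) :=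
  ContinuousMap.continuous (show C(ℝ≥0, ℂ) from f)

@[ext]
theorem ext {f g : ContFun} (h : ∀ t, f t = g t) : f = g := DFunLike.ext f g h

@[simp] theorem mk_apply (f : ℝ≥0 → ℂ) (hf : Continuous f) (t : ℝ≥0) : mk f hf t = f t := rfl
@[simp] theorem add_apply (f g : ContFun) (t : ℝ≥0) : (f + g) t = f t + g t := rfl
@[simp] theorem zero_apply (t : ℝ≥0) : (0 : ContFun) t = 0 := rfl
@[simp] theorem smul_apply (c : ℂ) (f : ContFun) (t : ℝ≥0) : (c • f) t = c * f t := rfl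

theorem continuous_ext (f : ContFun) : Continuous fun x : ℝ => f x.toNNReal :=
  f.continuous_coe.comp continuous_real_toNNReal

@[fun_prop]
theorem continuous_ext_comp {X : Type*} [TopologicalSpace X] (f : ContFun) {φ : X → ℝ}
    (hφ : Continuous φ) : Continuous fun x => f (φ x).toNNReal :=
  f.continuous_ext.comp hφ

/-- The convolution `{∫₀ᵗ f(t - u) g(u) du}`. For `0 ≤ u ≤ t` both `t - u` and `u` are nonnegative,
so that `Real.toNNReal` only adjusts the type. -/
def conv (f g : ContFun) : ContFun :=
  mk (fun t => ∫ u in (0 : ℝ)..t, f ((t : ℝ) - u).toNNReal * g u.toNNReal) <| by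
    refine intervalIntegral.continuous_parametric_intervalIntegral_of_continuous
      (f := fun (t : ℝ≥0) (u : ℝ) => f ((t : ℝ) - u).toNNReal * g u.toNNReal)
      (s := fun t : ℝ≥0 => (t : ℝ)) ?_ NNReal.continuous_coe
    simp only [Function.uncurry_def]
    exact (continuous_ext_comp f (by fun_prop)).mul (continuous_ext_comp g (by fun_prop))

instance : Mul ContFun := ⟨conv⟩

theorem mul_apply (f g : ContFun) (t : ℝ≥0) :
    (f * g) t = ∫ u in (0 : ℝ)..t, f ((t : ℝ) - u).toNNReal * g u.toNNReal := rfl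

theorem intble {φ : ℝ → ℂ} (h : Continuous φ) (a b : ℝ) :
    IntervalIntegrable φ MeasureTheory.volume a b := h.intervalIntegrable a b

theorem conv_comm (f g : ContFun) : f * g = g * f := by
  ext t
  rw [mul_apply, mul_apply]
  have := intervalIntegral.integral_comp_sub_left (a := 0) (b := (t : ℝ))
    (fun u => f u.toNNReal * g ((t : ℝ) - u).toNNReal) (t : ℝ)
  simp only [sub_self, sub_zero, sub_sub_cancel] at this
  rw [this]
  simp_rw [mul_comm]

theorem conv_add (f g h : ContFun) : f * (g + h) = f * g + f * h := by
  ext t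
  simp only [mul_apply, add_apply, mul_add]
  rw [intervalIntegral.integral_add] <;> apply intble <;>
    exact (continuous_ext_comp _ (by fun_prop)).mul (continuous_ext_comp _ (by fun_prop))

theorem conv_smul (c : ℂ) (f g : ContFun) : f * (c • g) = c • (f * g) := by
  ext t
  simp only [mul_apply, smul_apply]
  rw [← intervalIntegral.integral_const_mul]
  congr 1; ext u; ring

/-- Interchange of the order of integration over a triangle. -/
theorem triangle_swap (F : ℝ → ℝ → ℂ) (hF : Continuous fun p : ℝ × ℝ => F p.1 p.2) {t : ℝ}
    (ht : 0 ≤ t) :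
    ∫ w in (0 : ℝ)..t, ∫ u in (0 : ℝ)..w, F w u = ∫ u in (0 : ℝ)..t, ∫ w in u..t, F w u := by
  have h1 : ∫ w in (0 : ℝ)..t, ∫ u in (0 : ℝ)..w, F w u =
      ∫ w in Set.Ioc 0 t, ∫ u in Set.Ioc 0 t, (Set.Ici u).indicator (fun w => F w u) w := by
    rw [intervalIntegral.integral_of_le ht]
    refine MeasureTheory.setIntegral_congr_fun measurableSet_Ioc fun w hw => ?_
    have e : (fun u => (Set.Ici u).indicator (fun w => F w u) w)
        = (Set.Iic w).indicator (fun u => F w u) := by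
      ext u; simp [Set.indicator]
    simp only [e]
    rw [MeasureTheory.setIntegral_indicator measurableSet_Iic, intervalIntegral.integral_of_le hw.1.le]
    congr 2
    ext u; simp only [Set.mem_Ioc, Set.mem_inter_iff, Set.mem_Iic]
    exact ⟨fun h => ⟨⟨h.1, h.2.trans hw.2⟩, h.2⟩, fun h => ⟨h.1.1, h.2⟩⟩
  have h2 : ∫ u in (0 : ℝ)..t, ∫ w in u..t, F w u =
      ∫ u in Set.Ioc 0 t, ∫ w in Set.Ioc 0 t, (Set.Ici u).indicator (fun w => F w u) w := by
    rw [intervalIntegral.integral_of_le ht]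
    refine MeasureTheory.setIntegral_congr_fun measurableSet_Ioc fun u hu => ?_
    rw [MeasureTheory.setIntegral_indicator measurableSet_Ici, intervalIntegral.integral_of_le hu.2,
      ← MeasureTheory.integral_Icc_eq_integral_Ioc]
    congr 2
    ext w; simp only [Set.mem_Icc, Set.mem_Ioc, Set.mem_inter_iff, Set.mem_Ici]
    exact ⟨fun h => ⟨⟨hu.1.trans_le h.1, h.2⟩, h.1⟩, fun h => ⟨h.2, h.1.2⟩⟩
  rw [h1, h2]
  refine MeasureTheory.integral_integral_swap
    (f := fun w u => (Set.Ici u).indicator (fun w => F w u) w) ?_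
  rw [MeasureTheory.Measure.prod_restrict]
  have e : Function.uncurry (fun w u => (Set.Ici u).indicator (fun w => F w u) w)
      = {p : ℝ × ℝ | p.2 ≤ p.1}.indicator (fun p => F p.1 p.2) := by
    ext p; simp [Set.indicator, Function.uncurry]
  rw [e]
  refine MeasureTheory.Integrable.indicator ?_ (measurableSet_le measurable_snd measurable_fst)
  refine MeasureTheory.IntegrableOn.mono_set ?_
    (Set.prod_mono Set.Ioc_subset_Icc_self Set.Ioc_subset_Icc_self)
  exact hF.continuousOn.integrableOn_compact (isCompact_Icc.prod isCompact_Icc)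

theorem conv_assoc (f g h : ContFun) : f * g * h = f * (g * h) := by
  ext t
  have hl : ∀ u ∈ Set.uIcc (0 : ℝ) t, (f * g) ((t : ℝ) - u).toNNReal * h u.toNNReal =
      ∫ w in u..t, f ((t : ℝ) - w).toNNReal * (g (w - u).toNNReal * h u.toNNReal) := by
    intro u hu
    rw [Set.uIcc_of_le t.coe_nonneg] at hu
    rw [mul_apply, ← intervalIntegral.integral_mul_const,
      Real.coe_toNNReal _ (sub_nonneg.2 hu.2)]
    have := intervalIntegral.integral_comp_sub_right (a := u) (b := (t : ℝ))
      (fun v => f ((t : ℝ) - u - v).toNNReal * g v.toNNReal * h u.toNNReal) u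
    rw [sub_self] at this
    rw [← this]
    congr 1; ext w
    rw [show (t : ℝ) - u - (w - u) = t - w by ring]; ring
  have hr : ∀ w ∈ Set.uIcc (0 : ℝ) t, f ((t : ℝ) - w).toNNReal * (g * h) w.toNNReal =
      ∫ u in (0 : ℝ)..w, f ((t : ℝ) - w).toNNReal * (g (w - u).toNNReal * h u.toNNReal) := by
    intro w hw
    rw [Set.uIcc_of_le t.coe_nonneg] at hw
    rw [mul_apply, intervalIntegral.integral_const_mul, Real.coe_toNNReal _ hw.1]
  rw [mul_apply (f * g), mul_apply f, intervalIntegral.integral_congr hl,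
    intervalIntegral.integral_congr hr]
  refine (triangle_swap _ ?_ t.2).symm
  exact (continuous_ext_comp _ (by fun_prop)).mul
    ((continuous_ext_comp _ (by fun_prop)).mul (continuous_ext_comp _ (by fun_prop)))

/-- `𝒞` is a commutative ring without identity under addition and convolution. -/
instance : NonUnitalCommRing ContFun where
  left_distrib := conv_add
  right_distrib f g h := by rw [conv_comm, conv_add, conv_comm h, conv_comm h]
  zero_mul f := by ext t; simp [mul_apply]
  mul_zero f := by ext t; simp [mul_apply]
  mul_assoc := conv_assoc
  mul_comm := conv_comm

instance : SMulCommClass ℂ ContFun ContFun := ⟨fun c f g => (conv_smul c f g).symm⟩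

instance : IsScalarTower ℂ ContFun ContFun :=
  ⟨fun c f g => by
    rw [smul_eq_mul, smul_eq_mul, conv_comm, conv_smul, conv_comm]⟩

/-- The constant function `{α}`. -/
def const (α : ℂ) : ContFun := mk (fun _ => α) continuous_const

/-- The integral operator `l = {1}`. -/
def l : ContFun := const 1

/-- `{-t a(t)}`, the value of `d/ds` at `a = {a(t)}`. -/
def negMulId (a : ContFun) : ContFun :=
  mk (fun t => -((t : ℝ) : ℂ) * a t) <| by
    have := a.continuous_coe
    have := NNReal.continuous_coe
    fun_prop

/-- The `q`-scaling `τ_q {a(t)} = {q a(q t)}` on `𝒞`. -/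
def scale (q : ℝ≥0) (a : ContFun) : ContFun :=
  mk (fun t => ((q : ℝ) : ℂ) * a (q * t)) <| by
    have := a.continuous_coe
    fun_prop

@[simp] theorem scale_apply (q : ℝ≥0) (a : ContFun) (t : ℝ≥0) :
    scale q a t = ((q : ℝ) : ℂ) * a (q * t) := rfl

theorem scale_mul (q : ℝ≥0) (hq : 0 < q) (a b : ContFun) :
    scale q (a * b) = scale q a * scale q b := by
  ext t
  have hq' : (q : ℝ) ≠ 0 := by exact_mod_cast hq.ne'
  have e : ∀ x : ℝ, q * x.toNNReal = ((q : ℝ) * x).toNNReal := fun x => by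
    rw [Real.toNNReal_mul q.coe_nonneg, Real.toNNReal_coe]
  have := intervalIntegral.integral_comp_mul_left (a := 0) (b := (t : ℝ))
    (fun x => a ((q : ℝ) * t - x).toNNReal * b x.toNNReal) hq'
  rw [scale_apply, mul_apply, mul_apply]
  simp only [scale_apply, e]
  rw [mul_zero] at this
  have h2 : ∀ u : ℝ, ((q : ℝ) : ℂ) * a ((q : ℝ) * ((t : ℝ) - u)).toNNReal *
      (((q : ℝ) : ℂ) * b ((q : ℝ) * u).toNNReal) = ((q : ℝ) : ℂ) * (((q : ℝ) : ℂ) *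
      (a ((q : ℝ) * t - (q : ℝ) * u).toNNReal * b ((q : ℝ) * u).toNNReal)) := fun u => by
    rw [mul_sub]; ring
  simp only [h2]
  rw [intervalIntegral.integral_const_mul, intervalIntegral.integral_const_mul, this,
    NNReal.coe_mul, Complex.real_smul, ← mul_assoc ((q : ℝ) : ℂ) ((q : ℝ)⁻¹ : ℝ) , ← Complex.ofReal_mul,
    mul_inv_cancel₀ hq', Complex.ofReal_one, one_mul]

theorem negMulId_mul (a b : ContFun) :
    negMulId (a * b) = a * negMulId b + b * negMulId a := by
  rw [conv_comm b]
  ext t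
  have h : ∀ u ∈ Set.uIcc (0 : ℝ) t,
      -((t : ℝ) : ℂ) * (a ((t : ℝ) - u).toNNReal * b u.toNNReal) =
      a ((t : ℝ) - u).toNNReal * negMulId b u.toNNReal +
        negMulId a ((t : ℝ) - u).toNNReal * b u.toNNReal := by
    intro u hu
    rw [Set.uIcc_of_le t.coe_nonneg] at hu
    simp only [negMulId, mk_apply]
    rw [Real.coe_toNNReal _ (sub_nonneg.2 hu.2), Real.coe_toNNReal _ hu.1]
    push_cast; ring
  rw [add_apply, mul_apply, mul_apply, ← intervalIntegral.integral_add,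
    ← intervalIntegral.integral_congr h, intervalIntegral.integral_const_mul]
  · rfl
  all_goals
    exact intble ((continuous_ext_comp _ (by fun_prop)).mul
      (continuous_ext_comp _ (by fun_prop))) _ _

theorem l_mul_apply (f : ContFun) (t : ℝ≥0) : (l * f) t = ∫ u in (0 : ℝ)..t, f u.toNNReal := by
  simp [mul_apply, l, const]

theorem smul_l (α : ℂ) : α • l = const α := by
  ext t; simp [l, const]

theorem l_mul_injective {f : ContFun} (h : l * f = 0) : f = 0 := by
  have hc : Continuous fun x : ℝ => f x.toNNReal := f.continuous_ext
  have hz : ∀ x : ℝ, 0 ≤ x → ∫ u in (0 : ℝ)..x, f u.toNNReal = 0 := fun x hx => by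
    have := l_mul_apply f ⟨x, hx⟩
    rw [h] at this
    exact this.symm
  ext t
  have h1 := (hc.integral_hasStrictDerivAt 0 (t : ℝ)).hasDerivAt.hasDerivWithinAt (s := Set.Ici (t : ℝ))
  have h2 : HasDerivWithinAt (fun x : ℝ => ∫ u in (0 : ℝ)..x, f u.toNNReal) 0
      (Set.Ici (t : ℝ)) t :=
    (hasDerivWithinAt_const (t : ℝ) (Set.Ici (t : ℝ)) (0 : ℂ)).congr
      (fun x hx => hz x (t.2.trans hx)) (hz t t.2)
  have := (uniqueDiffWithinAt_Ici (t : ℝ)).eq_deriv _ h1 h2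
  simpa using this

end ContFun

open ContFun

/-- `𝒞` with an identity adjoined: the ring `ℂ ⊕ 𝒞`. -/
abbrev UnitalC : Type := Unitization ℂ ContFun

/-- Mikusiński's ring of fractions `Q(𝒞)`: the total ring of fractions of `𝒞`, taken after an
identity has been adjoined (which changes nothing, see `exists_frac` and `algebraMap_mul_l`: every
element is a fraction of two elements of `𝒞`, and `α ∈ ℂ` is `{α}/{1}`). That it is a field is not
part of the definition. -/
abbrev Q : Type := FractionRing UnitalC

/-- The canonical map `𝒞 → Q(𝒞)`. -/
def ι : ContFun →ₙ+* Q :=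
  ((algebraMap UnitalC Q : UnitalC →+* Q) : UnitalC →ₙ+* Q).comp
    (Unitization.inrNonUnitalAlgHom ℂ ContFun : ContFun →ₙ+* UnitalC)

theorem ι_apply (a : ContFun) : ι a = algebraMap UnitalC Q (a : UnitalC) := rfl

theorem inr_l_mem : ((l : ContFun) : UnitalC) ∈ UnitalC⁰ := by
  rw [mem_nonZeroDivisors_iff_right]
  intro x hx
  induction x using Unitization.ind with
  | inl_add_inr α f =>
    rw [add_mul, Unitization.inl_mul_inr, ← Unitization.inr_mul, ← Unitization.inr_add] at hx
    have h0 : α • l + f * l = 0 := Unitization.inr_injective (R := ℂ) hx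
    have hα : α = 0 := by
      have := DFunLike.congr_fun h0 0
      simpa [ContFun.mul_apply, l, ContFun.const] using this
    subst hα
    rw [zero_smul, zero_add, mul_comm] at h0
    rw [l_mul_injective h0]; simp

/-- The differential operator `s = 1/l`. -/
def s : Q := IsLocalization.mk' Q (1 : UnitalC) ⟨_, inr_l_mem⟩

theorem s_mul_l : s * ι l = 1 := by
  rw [s, ι_apply]
  rw [← map_one (algebraMap UnitalC Q)]
  exact IsLocalization.mk'_spec Q (1 : UnitalC) ⟨_, inr_l_mem⟩

/-- `α ∈ ℂ` is the fraction `{α}/{1}`. -/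
theorem algebraMap_mul_l (α : ℂ) : algebraMap ℂ Q α * ι l = ι (ContFun.const α) := by
  rw [ι_apply, ι_apply, IsScalarTower.algebraMap_apply ℂ UnitalC Q, ← map_mul,
    Unitization.algebraMap_eq_inl, Unitization.inl_mul_inr, smul_l]

theorem ι_injective : Function.Injective ι :=
  (IsFractionRing.injective UnitalC Q).comp Unitization.inr_injective

theorem exists_inr_eq_mul_l (x : UnitalC) : ∃ a : ContFun, (a : UnitalC) = x * (l : UnitalC) := by
  induction x using Unitization.ind with
  | inl_add_inr α f =>
    exact ⟨α • l + f * l, by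
      rw [add_mul, Unitization.inl_mul_inr, ← Unitization.inr_mul, ← Unitization.inr_add]⟩

/-- Every element of `Q(𝒞)` is a fraction `a/b` with `a, b ∈ 𝒞`. -/
theorem exists_frac (x : Q) : ∃ a b : ContFun, b ≠ 0 ∧ IsUnit (ι b) ∧ x * ι b = ι a := by
  obtain ⟨r, d, rfl⟩ := IsLocalization.exists_mk'_eq UnitalC⁰ x
  obtain ⟨a, ha⟩ := exists_inr_eq_mul_l r
  obtain ⟨b, hb⟩ := exists_inr_eq_mul_l d
  have hu : IsUnit (ι b) := by
    rw [ι_apply, hb]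
    exact IsLocalization.map_units Q ((d : UnitalC⁰) * ⟨_, inr_l_mem⟩)
  refine ⟨a, b, ?_, hu, ?_⟩
  · rintro rfl
    rw [map_zero] at hu
    exact not_isUnit_zero hu
  · rw [ι_apply, ι_apply, ha, hb, map_mul, map_mul, ← mul_assoc, IsLocalization.mk'_spec]

/-- `τ_q` on `𝒞`, as a homomorphism of (non-unital) `ℂ`-algebras. -/
def scaleHom (q : ℝ≥0) (hq : 0 < q) : ContFun →ₙₐ[ℂ] ContFun where
  toFun := scale q
  map_smul' c a := by ext t; simp; ring
  map_zero' := by ext t; simp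
  map_add' a b := by ext t; simp; ring
  map_mul' := scale_mul q hq

/-- `τ_q` on `ℂ ⊕ 𝒞`, acting as the identity on `ℂ`. -/
def scaleUnital (q : ℝ≥0) (hq : 0 < q) : UnitalC →ₐ[ℂ] UnitalC :=
  Unitization.lift ((Unitization.inrNonUnitalAlgHom ℂ ContFun).comp (scaleHom q hq))

@[simp] theorem scaleUnital_inr (q : ℝ≥0) (hq : 0 < q) (a : ContFun) :
    scaleUnital q hq (a : UnitalC) = (scale q a : ContFun) := by
  simp [scaleUnital, scaleHom]

theorem scaleUnital_comp (q r : ℝ≥0) (hq : 0 < q) (hr : 0 < r) (h : q * r = 1) (x : UnitalC) :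
    scaleUnital q hq (scaleUnital r hr x) = x := by
  suffices (scaleUnital q hq).comp (scaleUnital r hr) = AlgHom.id ℂ UnitalC from
    DFunLike.congr_fun this x
  apply Unitization.algHom_ext''
  intro a
  simp only [AlgHom.comp_apply, scaleUnital_inr, AlgHom.id_apply]
  congr 1
  ext t
  rw [scale_apply, scale_apply, ← mul_assoc, ← mul_assoc, mul_comm r q, h, ← Complex.ofReal_mul,
    ← NNReal.coe_mul, h]
  simp

theorem scaleUnital_le (q : ℝ≥0) (hq : 0 < q) :
    UnitalC⁰ ≤ UnitalC⁰.comap ((scaleUnital q hq : UnitalC →+* UnitalC)) := by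
  intro x hx
  rw [Submonoid.mem_comap, mem_nonZeroDivisors_iff_right]
  intro y hy
  have hq' : 0 < q⁻¹ := inv_pos.2 hq
  have e := scaleUnital_comp q q⁻¹ hq hq' (mul_inv_cancel₀ hq.ne')
  have e' := scaleUnital_comp q⁻¹ q hq' hq (inv_mul_cancel₀ hq.ne')
  have : scaleUnital q⁻¹ hq' y * x = 0 := by
    have := congrArg (scaleUnital q⁻¹ hq') hy
    simpa [e'] using this
  have := (mem_nonZeroDivisors_iff_right.1 hx) _ this
  rw [← e y, this, map_zero]

/-- The `q`-scaling `τ_q` on `Q(𝒞)`, defined by `τ_q (a/b) = τ_q a / τ_q b`. -/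
def tau (q : ℝ≥0) (hq : 0 < q) : Q →+* Q :=
  IsLocalization.map Q (scaleUnital q hq : UnitalC →+* UnitalC) (scaleUnital_le q hq)

theorem tau_ι (q : ℝ≥0) (hq : 0 < q) (a : ContFun) : tau q hq (ι a) = ι (scale q a) := by
  rw [tau, ι_apply, IsLocalization.map_eq, ι_apply]
  simp

/-- `d/ds` on `ℂ ⊕ 𝒞`: zero on `ℂ` and `{a(t)} ↦ {-t a(t)}` on `𝒞`. -/
def ddsUnital : Derivation ℂ UnitalC UnitalC :=
  Derivation.mk'
    { toFun := fun x => ((negMulId x.snd : ContFun) : UnitalC)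
      map_add' := fun x y => by
        rw [← Unitization.inr_add]; congr 1
        ext t; simp [negMulId]; ring
      map_smul' := fun c x => by
        rw [RingHom.id_apply, ← Unitization.inr_smul]; congr 1
        ext t; simp [negMulId]; ring }
    (by
      intro x y
      induction x using Unitization.ind with
      | inl_add_inr α a =>
      induction y using Unitization.ind with
      | inl_add_inr β b =>
      simp only [LinearMap.coe_mk, AddHom.coe_mk, smul_eq_mul, add_mul, Unitization.inl_mul_inr,
        ← Unitization.inr_mul]
      simp only [← Unitization.inr_add]
      congr 1
      have hl : ((Unitization.inl α + (a : UnitalC)) * (Unitization.inl β + (b : UnitalC))).snd =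
          α • b + β • a + a * b := by simp
      have ha : ((Unitization.inl α + (a : UnitalC))).snd = a := by simp
      have hb : ((Unitization.inl β + (b : UnitalC))).snd = b := by simp
      simp only [← add_mul]
      rw [hl, ha, hb]
      have hadd : ∀ x y : ContFun, negMulId (x + y) = negMulId x + negMulId y := by
        intro x y; ext t; simp [negMulId]; ring
      have hsm : ∀ (c : ℂ) (x : ContFun), negMulId (c • x) = c • negMulId x := by
        intro c x; ext t; simp [negMulId]; ring
      rw [hadd, hadd, hsm, hsm, negMulId_mul]
      abel)

theorem ddsUnital_inr (a : ContFun) : ddsUnital (a : UnitalC) = (negMulId a : ContFun) := rfl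

/-- The ring homomorphism `r ↦ r + ε r'` from `ℂ ⊕ 𝒞` to `Q(𝒞)[ε]`, `ε² = 0`. -/
def ddsDual : UnitalC →+* TrivSqZeroExt Q Q where
  toFun r := TrivSqZeroExt.inl (algebraMap UnitalC Q r) +
    TrivSqZeroExt.inr (algebraMap UnitalC Q (ddsUnital r))
  map_one' := by
    rw [map_one, Derivation.map_one_eq_zero, map_zero, TrivSqZeroExt.inr_zero, add_zero,
      TrivSqZeroExt.inl_one]
  map_zero' := by
    rw [map_zero, map_zero, map_zero, TrivSqZeroExt.inr_zero, add_zero, TrivSqZeroExt.inl_zero]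
  map_add' x y := by
    rw [map_add, map_add, map_add, TrivSqZeroExt.inl_add, TrivSqZeroExt.inr_add]
    abel
  map_mul' x y := by
    rw [Derivation.leibniz, map_mul, map_add, smul_eq_mul, smul_eq_mul, map_mul, map_mul,
      TrivSqZeroExt.inl_mul, TrivSqZeroExt.inr_add, mul_add, add_mul, add_mul,
      TrivSqZeroExt.inr_mul_inr, TrivSqZeroExt.inl_mul_inr, TrivSqZeroExt.inr_mul_inl,
      op_smul_eq_smul, smul_eq_mul, smul_eq_mul]
    abel

theorem ddsDual_fst (r : UnitalC) : (ddsDual r).fst = algebraMap UnitalC Q r := by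
  change TrivSqZeroExt.fst (TrivSqZeroExt.inl (algebraMap UnitalC Q r) +
    TrivSqZeroExt.inr (algebraMap UnitalC Q (ddsUnital r)) : TrivSqZeroExt Q Q) = _
  rw [TrivSqZeroExt.fst_add, TrivSqZeroExt.fst_inl, TrivSqZeroExt.fst_inr, add_zero]

theorem ddsDual_snd (r : UnitalC) : (ddsDual r).snd = algebraMap UnitalC Q (ddsUnital r) := by
  change TrivSqZeroExt.snd (TrivSqZeroExt.inl (algebraMap UnitalC Q r) +
    TrivSqZeroExt.inr (algebraMap UnitalC Q (ddsUnital r)) : TrivSqZeroExt Q Q) = _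
  rw [TrivSqZeroExt.snd_add, TrivSqZeroExt.snd_inl, TrivSqZeroExt.snd_inr, zero_add]

theorem ddsDual_isUnit (d : UnitalC⁰) : IsUnit (ddsDual d) := by
  rw [TrivSqZeroExt.isUnit_iff_isUnit_fst, ddsDual_fst]
  exact IsLocalization.map_units Q d

/-- The extension of `ddsDual` to `Q(𝒞)`. -/
def ddsDualQ : Q →+* TrivSqZeroExt Q Q :=
  IsLocalization.lift (M := UnitalC⁰) (g := ddsDual) ddsDual_isUnit

theorem ddsDualQ_algebraMap (r : UnitalC) : ddsDualQ (algebraMap UnitalC Q r) = ddsDual r :=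
  IsLocalization.lift_eq _ r

theorem ddsDualQ_fst (x : Q) : (ddsDualQ x).fst = x := by
  suffices ((TrivSqZeroExt.fstHom Q Q Q : TrivSqZeroExt Q Q →+* Q).comp ddsDualQ) = RingHom.id Q from
    DFunLike.congr_fun this x
  apply IsLocalization.ringHom_ext UnitalC⁰
  ext r
  change (ddsDualQ (algebraMap UnitalC Q r)).fst = algebraMap UnitalC Q r
  rw [ddsDualQ_algebraMap, ddsDual_fst]

/-- The derivation `d/ds` of `Q(𝒞)`: the unique one with `d/ds {a(t)} = {-t a(t)}`, i.e. the one
given on fractions by the quotient rule. -/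
def dds : Derivation ℂ Q Q :=
  Derivation.mk'
    { toFun := fun x => (ddsDualQ x).snd
      map_add' := fun x y => by rw [map_add, TrivSqZeroExt.snd_add]
      map_smul' := fun c x => by
        rw [RingHom.id_apply, Algebra.smul_def, Algebra.smul_def, map_mul, TrivSqZeroExt.snd_mul,
          IsScalarTower.algebraMap_apply ℂ UnitalC Q, ddsDualQ_algebraMap, ddsDual_fst,
          ddsDual_snd, Derivation.map_algebraMap, map_zero, op_smul_eq_smul, smul_zero, add_zero,
          smul_eq_mul] }
    (fun x y => by
      change (ddsDualQ (x * y)).snd = x • (ddsDualQ y).snd + y • (ddsDualQ x).snd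
      rw [map_mul, TrivSqZeroExt.snd_mul, ddsDualQ_fst, ddsDualQ_fst, op_smul_eq_smul])

theorem dds_ι (a : ContFun) : dds (ι a) = ι (negMulId a) := by
  change (ddsDualQ (algebraMap UnitalC Q (a : UnitalC))).snd = _
  rw [ddsDualQ_algebraMap, ddsDual_snd, ddsUnital_inr, ι_apply]

/-- The derivation `D = -s² d/ds` of `Q(𝒞)`. -/
def D : Derivation ℂ Q Q := (-s ^ 2) • dds

/-- `(K, δ, σ)` is a DT field: `K` is a field, `δ` a derivation of `K`, and `σ` a transforming
operator of `K`, i.e. an injective ring endomorphism. -/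
structure IsDTField (K : Type*) [CommRing K] (δ σ : K → K) : Prop where
  isField : IsField K
  deriv_add : ∀ a b, δ (a + b) = δ a + δ b
  deriv_mul : ∀ a b, δ (a * b) = δ a * b + a * δ b
  map_one : σ 1 = 1
  map_add : ∀ a b, σ (a + b) = σ a + σ b
  map_mul : ∀ a b, σ (a * b) = σ a * σ b
  injective : Function.Injective σ

end

end Mikusinski

/-! The substance is that `Q` is a field, that is, Titchmarsh's theorem: convolution on `[0, ∞)` has
no zero divisors.

Nilpotents are excluded first. If `f * f = 0`, then convolving with `e^{zt}` shows that the part of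
`∬_{[0,S]²} e^{z(S-u-v)} f(u) f(v)` over `u + v ≤ S` is zero. On the rest the exponent has real part
`≤ 0` when `Re z ≥ 0`. As the double integral is `(e^{zT} ∫₀^{2T} e^{-zu} f(u) du)²` for `S = 2T`,
the entire function `∫₀ᵀ e^{zu} f(T-u) du` is bounded on the right half plane; on the left it is
trivially bounded. Liouville makes it constant, so its derivatives at `0` kill all moments of `u
f(T-u)`, and Weierstrass gives `f = 0`.

For `f * g = 0`, multiplication by `-t` is a derivation of convolution, and in a reduced ring it
follows that `f * (t g) = 0`. Iterating, every moment of `u ↦ f(x+y-u) g(u)` on `[0, x+y]` vanishes,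
whence `f(x) g(y) = 0`.

The identities for `τ_q` and `D` are computed on `𝒞` and carried to fractions by multiplicativity
and the Leibniz rule. -/

namespace Mikusinski

noncomputable section

/-! ### Moments, and a Liouville argument for finite Laplace transforms -/

/-- A continuous real function on `[a, b]` whose moments all vanish is zero. -/
theorem eq_zero_of_moments_real {h : ℝ → ℝ} (hc : Continuous h) {a b : ℝ} (hab : a < b)
    (hm : ∀ n : ℕ, ∫ u in a..b, u ^ n * h u = 0) {u : ℝ} (hu : u ∈ Set.Icc a b) : h u = 0 := by
  have hp : ∀ p : Polynomial ℝ, ∫ u in a..b, p.eval u * h u = 0 := by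
    intro p
    induction p using Polynomial.induction_on' with
    | add p r hp hr =>
      simp only [Polynomial.eval_add, add_mul]
      rw [intervalIntegral.integral_add, hp, hr, add_zero] <;>
        exact (by fun_prop : Continuous _).intervalIntegrable _ _
    | monomial n c =>
      simp only [Polynomial.eval_monomial, mul_assoc]
      rw [intervalIntegral.integral_const_mul, hm, mul_zero]
  obtain ⟨M, hM⟩ := isCompact_Icc.exists_bound_of_continuousOn (s := Set.Icc a b) hc.continuousOn
  have hM0 : 0 ≤ M := (norm_nonneg _).trans (hM u hu)
  -- Polynomials are orthogonal to `h`, so in `∫ h²` one factor may be replaced by its error of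
  -- uniform approximation.
  have hle : ∀ ε > 0, ∫ u in a..b, h u * h u ≤ ε * (M * (b - a)) := by
    intro ε hε
    obtain ⟨p, hpε⟩ := exists_polynomial_near_of_continuousOn a b h hc.continuousOn ε hε
    have e : ∫ u in a..b, h u * h u = ∫ u in a..b, (h u - p.eval u) * h u := by
      simp only [sub_mul]
      rw [intervalIntegral.integral_sub, hp, sub_zero] <;>
        exact (by fun_prop : Continuous _).intervalIntegrable _ _
    have hn : ‖∫ u in a..b, (h u - p.eval u) * h u‖ ≤ ε * M * |b - a| := by
      refine intervalIntegral.norm_integral_le_of_norm_le_const fun x hx => ?_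
      rw [Set.uIoc_of_le hab.le] at hx
      have hx' := Set.Ioc_subset_Icc_self hx
      rw [norm_mul, norm_sub_rev]
      exact mul_le_mul (hpε x hx').le (hM x hx') (norm_nonneg _) hε.le
    rw [e]
    rw [abs_of_pos (sub_pos.2 hab), mul_assoc] at hn
    exact (le_abs_self _).trans hn
  by_contra hne
  have hpos : 0 < ∫ u in a..b, h u * h u :=
    intervalIntegral.integral_pos hab (hc.mul hc).continuousOn (fun x _ => mul_self_nonneg _)
      ⟨u, hu, mul_self_pos.2 hne⟩
  set I := ∫ u in a..b, h u * h u
  -- The `+ 1` makes the quotient in the choice of `ε` strictly smaller than needed: `I ≤ I K / (K +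
  -- 1)` with `K = M (b - a)` contradicts `I > 0`.
  have hK : 0 < M * (b - a) + 1 := by
    have := mul_nonneg hM0 (sub_pos.2 hab).le
    linarith
  have := hle (I / (M * (b - a) + 1)) (by positivity)
  rw [div_mul_eq_mul_div, le_div_iff₀ hK] at this
  nlinarith

/-- A continuous complex function on `[a, b]` whose moments all vanish is zero. -/
theorem eq_zero_of_moments {h : ℝ → ℂ} (hc : Continuous h) {a b : ℝ} (hab : a < b)
    (hm : ∀ n : ℕ, ∫ u in a..b, (u : ℂ) ^ n * h u = 0) {u : ℝ} (hu : u ∈ Set.Icc a b) :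
    h u = 0 := by
  have hi : ∀ n : ℕ, IntervalIntegrable (fun u : ℝ => (u : ℂ) ^ n * h u) MeasureTheory.volume a b :=
    fun n => (by fun_prop : Continuous _).intervalIntegrable _ _
  apply Complex.ext
  · refine eq_zero_of_moments_real (h := fun u => (h u).re) (by fun_prop) hab (fun n => ?_) hu
    have := Complex.reCLM.intervalIntegral_comp_comm (hi n)
    rw [hm, map_zero] at this
    simpa [← Complex.ofReal_pow] using this
  · refine eq_zero_of_moments_real (h := fun u => (h u).im) (by fun_prop) hab (fun n => ?_) hu
    have := Complex.imCLM.intervalIntegral_comp_comm (hi n)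
    rw [hm, map_zero] at this
    simpa [← Complex.ofReal_pow] using this

/-- Differentiation under the integral sign: the derivative of the integrand is bounded on the
compact set `closedBall z 1 × [[0, T]]`. Each derivative in `z` multiplies `k` by `u`, which is how
moments arise. -/
theorem hasDerivAt_integral_exp {k : ℝ → ℂ} (hk : Continuous k) (T : ℝ) (z : ℂ) :
    HasDerivAt (fun z : ℂ => ∫ u in (0 : ℝ)..T, Complex.exp (z * u) * k u)
      (∫ u in (0 : ℝ)..T, Complex.exp (z * u) * (u * k u)) z := by
  have hF : Continuous fun p : ℂ × ℝ => Complex.exp (p.1 * p.2) * (p.2 * k p.2) := by fun_prop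
  obtain ⟨C, hC⟩ := ((isCompact_closedBall z 1).prod
    (isCompact_uIcc (a := (0 : ℝ)) (b := T))).exists_bound_of_continuousOn hF.continuousOn
  refine (intervalIntegral.hasDerivAt_integral_of_dominated_loc_of_deriv_le
    (F := fun (z : ℂ) (u : ℝ) => Complex.exp (z * u) * k u)
    (F' := fun (z : ℂ) (u : ℝ) => Complex.exp (z * u) * (u * k u)) (bound := fun _ => C)
    (Metric.ball_mem_nhds z one_pos) ?_ ?_ ?_ ?_ ?_ ?_).2
  · exact Filter.Eventually.of_forall fun w =>
      (by fun_prop : Continuous fun u : ℝ => Complex.exp (w * u) * k u).aestronglyMeasurable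
  · exact (by fun_prop : Continuous fun u : ℝ => Complex.exp (z * u) * k u).intervalIntegrable _ _
  · exact (by fun_prop :
      Continuous fun u : ℝ => Complex.exp (z * u) * (u * k u)).aestronglyMeasurable
  · exact Filter.Eventually.of_forall fun u hu w hw =>
      hC (w, u) ⟨Metric.ball_subset_closedBall hw, Set.uIoc_subset_uIcc hu⟩
  · exact intervalIntegrable_const
  · refine Filter.Eventually.of_forall fun u _ w _ => ?_
    have := (((hasDerivAt_id w).mul_const (u : ℂ)).cexp).mul_const (k u)
    simpa [mul_assoc] using this

/-- If `z ↦ ∫₀ᵀ e^{zu} k(u) du` is bounded on `ℂ`, then `k` vanishes on `(0, T]`. -/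
theorem eq_zero_of_bounded_integral_exp {k : ℝ → ℂ} (hk : Continuous k) {T C : ℝ}
    (hb : ∀ z : ℂ, ‖∫ u in (0 : ℝ)..T, Complex.exp (z * u) * k u‖ ≤ C)
    {u : ℝ} (hu : u ∈ Set.Ioc 0 T) : k u = 0 := by
  have hconst : ∀ z : ℂ, ∫ u in (0 : ℝ)..T, Complex.exp (z * u) * (u * k u) = 0 := by
    obtain ⟨c, hc⟩ := Differentiable.exists_const_forall_eq_of_bounded
      (f := fun z : ℂ => ∫ u in (0 : ℝ)..T, Complex.exp (z * u) * k u)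
      (fun z => (hasDerivAt_integral_exp hk T z).differentiableAt)
      (isBounded_iff_forall_norm_le.2 ⟨C, Set.forall_mem_range.2 hb⟩)
    intro z
    have := hasDerivAt_integral_exp hk T z
    rw [funext hc] at this
    exact this.unique (hasDerivAt_const z c)
  have hmom : ∀ (n : ℕ) (z : ℂ),
      ∫ u in (0 : ℝ)..T, Complex.exp (z * u) * ((u : ℂ) ^ n * (u * k u)) = 0 := by
    intro n
    induction n with
    | zero => simpa using hconst
    | succ n ih =>
      intro z
      have := hasDerivAt_integral_exp (k := fun u => (u : ℂ) ^ n * (u * k u)) (by fun_prop) T z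
      rw [funext ih] at this
      rw [← this.unique (hasDerivAt_const z 0)]
      congr 1; ext u; ring
  -- At `z = 0` the exponential is `1`. Only moments of `u k(u)` are available, as Liouville says
  -- nothing about the value of the constant; hence the exclusion of `u = 0`.
  have := eq_zero_of_moments (h := fun u => (u : ℂ) * k u) (by fun_prop) (hu.1.trans_le hu.2)
    (fun n => by simpa using hmom n 0) (Set.Ioc_subset_Icc_self hu)
  exact (mul_eq_zero.1 this).resolve_left (by exact_mod_cast hu.1.ne')

/-! ### Absence of nilpotents -/

namespace ContFun

/-- The exponential `{e^{zt}}`. -/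
def exp (z : ℂ) : ContFun :=
  mk (fun t => Complex.exp (z * (t : ℝ))) <| by
    have := NNReal.continuous_coe
    fun_prop

theorem exp_toNNReal (z : ℂ) {x : ℝ} (hx : 0 ≤ x) :
    exp z x.toNNReal = Complex.exp (z * x) := by
  simp [exp, Real.coe_toNNReal x hx]

theorem norm_exp_le_one {z : ℂ} {x : ℝ} (h : z.re * x ≤ 0) : ‖Complex.exp (z * x)‖ ≤ 1 := by
  rw [Complex.norm_exp, Complex.re_mul_ofReal]
  exact Real.exp_le_one_iff.2 h

/-- `∬_{[0,S]²} e^{z(S-u-v)} f(u) f(v)` is bounded for `Re z ≥ 0` if `f * f = 0`. -/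
theorem norm_exp_mul_sq_le {f : ContFun} (hf : f * f = 0) {S M : ℝ} (hS : 0 ≤ S)
    (hM : ∀ u ∈ Set.Icc 0 S, ‖f u.toNNReal‖ ≤ M) {z : ℂ} (hz : 0 ≤ z.re) :
    ‖Complex.exp (z * S) * (∫ u in (0 : ℝ)..S, Complex.exp (-(z * u)) * f u.toNNReal) ^ 2‖ ≤
      (M * S) ^ 2 := by
  have hM0 : 0 ≤ M := (norm_nonneg _).trans (hM 0 ⟨le_rfl, hS⟩)
  set Φ := ∫ u in (0 : ℝ)..S, Complex.exp (-(z * u)) * f u.toNNReal with hΦ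
  set g : ℝ → ℝ → ℂ := fun u v => Complex.exp (z * ((S - u - v : ℝ) : ℂ)) * f v.toNNReal with hg
  have hgc : Continuous fun p : ℝ × ℝ => g p.1 p.2 := by
    simp only [hg]
    exact (by fun_prop : Continuous fun p : ℝ × ℝ =>
      Complex.exp (z * ((S - p.1 - p.2 : ℝ) : ℂ))).mul (continuous_ext_comp f (by fun_prop))
  have hgi : ∀ u a b, IntervalIntegrable (g u) MeasureTheory.volume a b := fun u a b =>
    (hgc.comp (by fun_prop : Continuous fun v : ℝ => (u, v))).intervalIntegrable a b
  -- The integral over the triangle `u + v ≤ S` is the value at `S` of `e^{zt} * f * f`.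
  have h0 : ∫ u in (0 : ℝ)..S, (∫ v in (0 : ℝ)..(S - u), g u v) * f u.toNNReal = 0 := by
    have : (exp z * f * f) S.toNNReal = 0 := by rw [conv_assoc, hf, mul_zero, zero_apply]
    rw [mul_apply, Real.coe_toNNReal S hS] at this
    rw [← this]
    refine intervalIntegral.integral_congr fun u hu => ?_
    simp only [Set.uIcc_of_le hS] at hu
    have hu' : 0 ≤ S - u := sub_nonneg.2 hu.2
    change _ = (exp z * f) (S - u).toNNReal * f u.toNNReal
    rw [mul_apply, Real.coe_toNNReal _ hu']
    congr 1
    refine intervalIntegral.integral_congr fun v hv => ?_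
    simp only [Set.uIcc_of_le hu'] at hv
    simp only [hg]
    rw [exp_toNNReal z (sub_nonneg.2 hv.2)]
  have h1 : Complex.exp (z * S) * Φ ^ 2 =
      ∫ u in (0 : ℝ)..S, (∫ v in (0 : ℝ)..S, g u v) * f u.toNNReal := by
    have : ∀ u : ℝ, (∫ v in (0 : ℝ)..S, g u v) * f u.toNNReal =
        Complex.exp (z * S) * Φ * (Complex.exp (-(z * u)) * f u.toNNReal) := by
      intro u
      have : ∫ v in (0 : ℝ)..S, g u v = Complex.exp (z * S) * Complex.exp (-(z * u)) * Φ := by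
        rw [hΦ, ← intervalIntegral.integral_const_mul]
        congr 1; ext v
        simp only [hg]
        rw [← mul_assoc, ← Complex.exp_add, ← Complex.exp_add]
        congr 2; push_cast; ring
      rw [this]; ring
    simp only [this]
    rw [intervalIntegral.integral_const_mul, ← hΦ]; ring
  -- Removing the null triangle leaves `u + v ≥ S`, where `Re z (S - u - v) ≤ 0`.
  have h2 : Complex.exp (z * S) * Φ ^ 2 =
      ∫ u in (0 : ℝ)..S, (∫ v in (S - u)..S, g u v) * f u.toNNReal := by
    rw [h1, ← sub_zero (∫ u in (0 : ℝ)..S, _), ← h0, ← intervalIntegral.integral_sub]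
    · congr 1; ext u
      rw [← intervalIntegral.integral_add_adjacent_intervals (hgi u 0 (S - u)) (hgi u (S - u) S)]
      ring
    · exact ((intervalIntegral.continuous_parametric_intervalIntegral_of_continuous hgc
        continuous_const).mul f.continuous_ext).intervalIntegrable _ _
    · exact ((intervalIntegral.continuous_parametric_intervalIntegral_of_continuous hgc
        (by fun_prop)).mul f.continuous_ext).intervalIntegrable _ _
  rw [h2]
  have h3 : ∀ u ∈ Set.uIoc 0 S, ‖(∫ v in (S - u)..S, g u v) * f u.toNNReal‖ ≤ M * S * M := by
    intro u hu
    rw [Set.uIoc_of_le hS] at hu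
    rw [norm_mul]
    refine mul_le_mul ?_ (hM u (Set.Ioc_subset_Icc_self hu)) (norm_nonneg _) (by positivity)
    have : ‖∫ v in (S - u)..S, g u v‖ ≤ M * |S - (S - u)| := by
      refine intervalIntegral.norm_integral_le_of_norm_le_const fun v hv => ?_
      rw [Set.uIoc_of_le (by linarith [hu.1])] at hv
      simp only [hg]
      rw [norm_mul, ← one_mul M]
      refine mul_le_mul (norm_exp_le_one ?_) (hM v ⟨?_, hv.2⟩) (norm_nonneg _) zero_le_one
      · exact mul_nonpos_of_nonneg_of_nonpos hz (by linarith [hv.1])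
      · linarith [hv.1, hu.2]
    refine this.trans ?_
    rw [sub_sub_cancel, abs_of_pos hu.1]
    exact mul_le_mul_of_nonneg_left hu.2 hM0
  refine (intervalIntegral.norm_integral_le_of_norm_le_const h3).trans_eq ?_
  rw [sub_zero, abs_of_nonneg hS]; ring

/-- The convolution ring is reduced. -/
theorem eq_zero_of_mul_self {f : ContFun} (hf : f * f = 0) : f = 0 := by
  have key : ∀ T : ℝ, 0 < T → ∀ u ∈ Set.Ioc 0 T, f (T - u).toNNReal = 0 := by
    intro T hT u hu
    obtain ⟨M, hM⟩ := (isCompact_Icc (a := (0 : ℝ)) (b := 2 * T)).exists_bound_of_continuousOn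
      f.continuous_ext.continuousOn
    have hM0 : 0 ≤ M := (norm_nonneg _).trans (hM 0 ⟨le_rfl, by positivity⟩)
    refine eq_zero_of_bounded_integral_exp (k := fun u => f (T - u).toNNReal) (T := T)
      (C := M * (2 * T) + M * T) (f.continuous_ext_comp (by fun_prop)) (fun z => ?_) hu
    rcases le_total z.re 0 with hz | hz
    · have : ‖∫ u in (0 : ℝ)..T, Complex.exp (z * u) * f (T - u).toNNReal‖ ≤ M * |T - 0| := by
        refine intervalIntegral.norm_integral_le_of_norm_le_const fun v hv => ?_
        rw [Set.uIoc_of_le hT.le] at hv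
        rw [norm_mul, ← one_mul M]
        exact mul_le_mul (norm_exp_le_one (mul_nonpos_of_nonpos_of_nonneg hz hv.1.le))
          (hM _ ⟨by linarith [hv.2], by linarith [hv.1]⟩) (norm_nonneg _) zero_le_one
      rw [sub_zero, abs_of_pos hT] at this
      have h' : 0 ≤ M * (2 * T) := by positivity
      linarith
    -- Right half plane: the integral over `[0, T]` is the one over `[0, 2T]`, bounded by the square
    -- root of the estimate for `S = 2T`, minus the one over `[T, 2T]`, where the exponential is at
    -- most `1`.
    · have hsub := intervalIntegral.integral_comp_sub_left (a := 0) (b := T)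
        (fun u : ℝ => Complex.exp (z * ((T - u : ℝ) : ℂ)) * f u.toNNReal) T
      simp only [sub_sub_cancel, sub_self, sub_zero] at hsub
      rw [hsub]
      have hi : ∀ a b, IntervalIntegrable
          (fun u : ℝ => Complex.exp (z * ((T - u : ℝ) : ℂ)) * f u.toNNReal)
          MeasureTheory.volume a b := fun a b =>
        ((by fun_prop : Continuous fun u : ℝ => Complex.exp (z * ((T - u : ℝ) : ℂ))).mul
          f.continuous_ext).intervalIntegrable a b
      rw [eq_sub_of_add_eq (intervalIntegral.integral_add_adjacent_intervals (hi 0 T)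
        (hi T (2 * T)))]
      refine (norm_sub_le _ _).trans (add_le_add ?_ ?_)
      · have hsq := norm_exp_mul_sq_le hf (by positivity) hM hz
        have e : ∫ u in (0 : ℝ)..(2 * T), Complex.exp (z * ((T - u : ℝ) : ℂ)) * f u.toNNReal =
            Complex.exp (z * T) *
              ∫ u in (0 : ℝ)..(2 * T), Complex.exp (-(z * u)) * f u.toNNReal := by
          rw [← intervalIntegral.integral_const_mul]
          congr 1; ext v
          rw [← mul_assoc, ← Complex.exp_add]
          congr 2; push_cast; ring
        have e2 : Complex.exp (z * ((2 * T : ℝ) : ℂ)) = Complex.exp (z * T) ^ 2 := by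
          rw [← Complex.exp_nat_mul]; congr 1; push_cast; ring
        rw [e2, ← mul_pow, ← e, norm_pow] at hsq
        exact (sq_le_sq₀ (norm_nonneg _) (by positivity)).1 hsq
      · have : ‖∫ u in T..(2 * T), Complex.exp (z * ((T - u : ℝ) : ℂ)) * f u.toNNReal‖ ≤
            M * |2 * T - T| := by
          refine intervalIntegral.norm_integral_le_of_norm_le_const fun v hv => ?_
          rw [Set.uIoc_of_le (by linarith)] at hv
          rw [norm_mul, ← one_mul M]
          exact mul_le_mul
            (norm_exp_le_one (mul_nonpos_of_nonneg_of_nonpos hz (by linarith [hv.1])))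
            (hM _ ⟨by linarith [hv.1], hv.2⟩) (norm_nonneg _) zero_le_one
        rwa [show 2 * T - T = T by ring, abs_of_pos hT] at this
  ext t
  -- With `T = t + 1` and `u = 1`, also `t = 0` is reached from the half-open range of `u`.
  have := key ((t : ℝ) + 1) (by positivity) 1 ⟨one_pos, by linarith [t.coe_nonneg]⟩
  simpa using this

/-! ### Titchmarsh's theorem and the passage to `ℂ ⊕ 𝒞` -/

/-- Write `'` for the derivation. From `f g' + g f' = 0` and `f g = 0`, the square of `f g'` is `f
g' (f g' + g f') - f g g' f' = 0`, and the ring is reduced. -/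
theorem mul_negMulId_eq_zero {f g : ContFun} (h : f * g = 0) : f * negMulId g = 0 := by
  have hd : f * negMulId g + g * negMulId f = 0 := by
    rw [← negMulId_mul, h]; ext t; simp [negMulId]
  apply eq_zero_of_mul_self
  calc f * negMulId g * (f * negMulId g)
      = f * negMulId g * (f * negMulId g + g * negMulId f)
        - f * g * (negMulId g * negMulId f) := by
        rw [mul_add, mul_mul_mul_comm f _ g, add_sub_cancel_right]
    _ = 0 := by rw [hd, h, mul_zero, zero_mul, sub_zero]

/-- Positive points are wanted because the moment argument needs an interval of positive length. -/
theorem exists_pos_ne_zero {f : ContFun} (hf : f ≠ 0) : ∃ x : ℝ≥0, 0 < x ∧ f x ≠ 0 := by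
  by_contra! hz
  refine hf (l_mul_injective ?_)
  ext t
  rw [l_mul_apply, zero_apply]
  refine intervalIntegral.integral_zero_ae (Filter.Eventually.of_forall fun u hu => ?_)
  rw [Set.uIoc_of_le t.coe_nonneg] at hu
  exact hz _ (Real.toNNReal_pos.2 hu.1)

/-- Titchmarsh's theorem on `[0, ∞)`: the convolution ring has no zero divisors. -/
instance : NoZeroDivisors ContFun where
  eq_zero_or_eq_zero_of_mul_eq_zero {f g} h := by
    have hit : ∀ n : ℕ, f * negMulId^[n] g = 0 := by
      intro n
      induction n with
      | zero => exact h
      | succ n ih => rw [Function.iterate_succ_apply']; exact mul_negMulId_eq_zero ih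
    have hval : ∀ (n : ℕ) (t : ℝ≥0), (negMulId^[n] g) t = (-((t : ℝ) : ℂ)) ^ n * g t := by
      intro n t
      induction n with
      | zero => simp
      | succ n ih =>
        rw [Function.iterate_succ_apply']
        simp only [negMulId, mk_apply] at ih ⊢
        rw [ih]; ring
    have hpos : ∀ x y : ℝ≥0, 0 < x + y → f x * g y = 0 := by
      intro x y hxy
      have := eq_zero_of_moments (a := 0) (b := ((x + y : ℝ≥0) : ℝ)) (u := y)
        (h := fun u : ℝ => f (((x + y : ℝ≥0) : ℝ) - u).toNNReal * g u.toNNReal)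
        ((f.continuous_ext_comp (by fun_prop)).mul g.continuous_ext) (by exact_mod_cast hxy)
        (fun n => ?_) ⟨y.2, by simp⟩
      · simpa using this
      · have hn := DFunLike.congr_fun (hit n) (x + y)
        rw [mul_apply, zero_apply] at hn
        -- Restores the sign `(-1)^n` coming from multiplication by `-t`.
        rw [← mul_eq_zero_iff_left (pow_ne_zero n (neg_ne_zero.2 (one_ne_zero (α := ℂ)))),
          ← intervalIntegral.integral_const_mul, ← hn]
        refine intervalIntegral.integral_congr fun u hu => ?_
        simp only [Set.uIcc_of_le (NNReal.coe_nonneg _)] at hu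
        simp only [hval, Real.coe_toNNReal _ hu.1]
        rw [neg_pow (u : ℂ)]; ring
    by_contra! hne
    obtain ⟨x, hx, hfx⟩ := exists_pos_ne_zero hne.1
    obtain ⟨y, hy, hgy⟩ := exists_pos_ne_zero hne.2
    exact mul_ne_zero hfx hgy (hpos x y (add_pos hx hy))

end ContFun

open ContFun

/-- Multiplication by `l` moves both factors into `𝒞`, and `l` is not a zero divisor. -/
instance : NoZeroDivisors UnitalC where
  eq_zero_or_eq_zero_of_mul_eq_zero {x y} h := by
    obtain ⟨a, ha⟩ := exists_inr_eq_mul_l x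
    obtain ⟨b, hb⟩ := exists_inr_eq_mul_l y
    have hab : ((a * b : ContFun) : UnitalC) = ((0 : ContFun) : UnitalC) := by
      rw [Unitization.inr_mul, ha, hb, mul_mul_mul_comm, h, zero_mul, Unitization.inr_zero]
    have hl : ∀ {x : UnitalC} {a : ContFun}, (a : UnitalC) = x * (l : UnitalC) → a = 0 → x = 0 := by
      rintro x a ha rfl
      rw [Unitization.inr_zero] at ha
      exact mem_nonZeroDivisors_iff_right.1 inr_l_mem x ha.symm
    exact (mul_eq_zero.1 (Unitization.inr_injective hab)).imp (hl ha) (hl hb)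

instance : IsDomain UnitalC := NoZeroDivisors.to_isDomain _

/-! ### The automorphism `τ_q` -/

theorem tau_algebraMap (q : ℝ≥0) (hq : 0 < q) (α : ℂ) :
    tau q hq (algebraMap ℂ Q α) = algebraMap ℂ Q α := by
  rw [IsScalarTower.algebraMap_apply ℂ UnitalC Q, tau, IsLocalization.map_eq]
  congr 1
  exact (scaleUnital q hq).commutes α

theorem ι_smul (c : ℂ) (a : ContFun) : ι (c • a) = algebraMap ℂ Q c * ι a := by
  rw [ι_apply, ι_apply, Unitization.inr_smul, Algebra.smul_def, map_mul,
    ← IsScalarTower.algebraMap_apply ℂ UnitalC Q]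

theorem tau_tau_of_mul_eq_one {q r : ℝ≥0} (hq : 0 < q) (hr : 0 < r) (h : q * r = 1) (x : Q) :
    tau q hq (tau r hr x) = x := by
  suffices (tau q hq).comp (tau r hr) = RingHom.id Q from DFunLike.congr_fun this x
  apply IsLocalization.ringHom_ext UnitalC⁰
  ext r'
  simp only [RingHom.comp_apply, tau, IsLocalization.map_eq, RingHom.id_apply]
  congr 1
  exact scaleUnital_comp q r hq hr h r'

theorem tau_bijective (q : ℝ≥0) (hq : 0 < q) : Function.Bijective (tau q hq) :=
  Function.bijective_iff_has_inverse.2 ⟨tau q⁻¹ (inv_pos.2 hq),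
    tau_tau_of_mul_eq_one _ _ (inv_mul_cancel₀ hq.ne'),
    tau_tau_of_mul_eq_one _ _ (mul_inv_cancel₀ hq.ne')⟩

theorem tau_l (q : ℝ≥0) (hq : 0 < q) :
    tau q hq (ι l) = algebraMap ℂ Q ((q : ℝ) : ℂ) * ι l := by
  rw [tau_ι, ← ι_smul]
  congr 1

theorem ι_l_mul_s : ι l * s = 1 := by rw [mul_comm, s_mul_l]

theorem tau_s (q : ℝ≥0) (hq : 0 < q) :
    tau q hq s = algebraMap ℂ Q (((q : ℝ) : ℂ)⁻¹) * s := by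
  have hq' : ((q : ℝ) : ℂ) ≠ 0 := by exact_mod_cast hq.ne'
  have h := congrArg (tau q hq) s_mul_l
  rw [map_mul, map_one, tau_l] at h
  have hc : algebraMap ℂ Q (((q : ℝ) : ℂ)⁻¹) * algebraMap ℂ Q ((q : ℝ) : ℂ) = 1 := by
    rw [← map_mul, inv_mul_cancel₀ hq', map_one]
  calc tau q hq s
      = tau q hq s * (algebraMap ℂ Q (((q : ℝ) : ℂ)⁻¹) * algebraMap ℂ Q ((q : ℝ) : ℂ)) *
          (ι l * s) := by rw [hc, ι_l_mul_s, mul_one, mul_one]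
    _ = algebraMap ℂ Q (((q : ℝ) : ℂ)⁻¹) *
          (tau q hq s * (algebraMap ℂ Q ((q : ℝ) : ℂ) * ι l)) * s := by ring
    _ = _ := by rw [h, mul_one]

/-! ### The derivation `D` and its commutation with `τ_q` -/

theorem D_apply (x : Q) : D x = -s ^ 2 * dds x := rfl

theorem D_l : D (ι l) = 1 := by
  have h : negMulId l = (-1 : ℂ) • (l * l) := by
    ext t
    rw [smul_apply, l_mul_apply]
    simp [negMulId, l, const]
  rw [D_apply, dds_ι, h, ι_smul, map_mul, map_neg, map_one]
  linear_combination (s * ι l + 1) * s_mul_l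

theorem scale_negMulId (q : ℝ≥0) (a : ContFun) :
    negMulId (scale q a) = ((q : ℝ) : ℂ)⁻¹ • scale q (negMulId a) := by
  ext t
  -- For `q = 0` both sides vanish, the inverse of `0` being `0`.
  by_cases hq : ((q : ℝ) : ℂ) = 0
  · simp [negMulId, hq]
  · simp only [negMulId, mk_apply, scale_apply, smul_apply, NNReal.coe_mul, Complex.ofReal_mul]
    field_simp

theorem dds_tau (q : ℝ≥0) (hq : 0 < q) (x : Q) :
    algebraMap ℂ Q ((q : ℝ) : ℂ) * dds (tau q hq x) = tau q hq (dds x) := by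
  have hq' : ((q : ℝ) : ℂ) ≠ 0 := by exact_mod_cast hq.ne'
  have hι : ∀ a : ContFun,
      algebraMap ℂ Q ((q : ℝ) : ℂ) * dds (tau q hq (ι a)) = tau q hq (dds (ι a)) := by
    intro a
    rw [tau_ι, dds_ι, dds_ι, tau_ι, scale_negMulId, ι_smul, ← mul_assoc, ← map_mul,
      mul_inv_cancel₀ hq', map_one, one_mul]
  obtain ⟨a, b, -, hb, hx⟩ := exists_frac x
  -- Quotient rule: with `x b = a`, Leibniz expresses the claim for `x`, times the unit `τ_q b`,
  -- through the known claims for `a` and `b`.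
  apply (hb.map (tau q hq)).mul_left_cancel
  have h1 := hι a
  have h2 := hι b
  rw [← hx, Derivation.leibniz, smul_eq_mul, smul_eq_mul, map_add, map_mul (tau q hq),
    map_mul (tau q hq), map_mul (tau q hq), Derivation.leibniz, smul_eq_mul, smul_eq_mul] at h1
  linear_combination h1 - tau q hq x * h2

theorem D_tau (q : ℝ≥0) (hq : 0 < q) (x : Q) :
    D (tau q hq x) = algebraMap ℂ Q ((q : ℝ) : ℂ) * tau q hq (D x) := by
  have hq' : ((q : ℝ) : ℂ) ≠ 0 := by exact_mod_cast hq.ne'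
  have hc : algebraMap ℂ Q (((q : ℝ) : ℂ)⁻¹) * algebraMap ℂ Q ((q : ℝ) : ℂ) = 1 := by
    rw [← map_mul, inv_mul_cancel₀ hq', map_one]
  rw [D_apply, D_apply, map_mul, map_neg, map_pow, tau_s, ← dds_tau]
  set c := algebraMap ℂ Q ((q : ℝ) : ℂ)
  set c' := algebraMap ℂ Q (((q : ℝ) : ℂ)⁻¹)
  linear_combination (s ^ 2 * dds (tau q hq x)) * (c' * c + 1) * hc

theorem isDTField (q : ℝ≥0) (hq : 0 < q) : IsDTField Q D (tau q hq) where
  isField := (IsFractionRing.toField UnitalC (K := Q)).toIsField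
  deriv_add := map_add D
  deriv_mul a b := by rw [Derivation.leibniz, smul_eq_mul, smul_eq_mul]; ring
  map_one := map_one _
  map_add := map_add _
  map_mul := map_mul _
  injective := (tau_bijective q hq).1

end

end Mikusinski

theorem theorem3p4 (q : NNReal) (hq : 0 < q) :
    (∀ a : Mikusinski.ContFun,
      Mikusinski.tau q hq (Mikusinski.ι a) = Mikusinski.ι (Mikusinski.ContFun.scale q a)) ∧
    Function.Bijective (Mikusinski.tau q hq) ∧
    (∀ α : ℂ, Mikusinski.tau q hq (algebraMap ℂ Mikusinski.Q α) = algebraMap ℂ Mikusinski.Q α) ∧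
    Mikusinski.tau q hq (Mikusinski.ι Mikusinski.ContFun.l) =
      algebraMap ℂ Mikusinski.Q ((q : ℝ) : ℂ) * Mikusinski.ι Mikusinski.ContFun.l ∧
    Mikusinski.tau q hq Mikusinski.s =
      algebraMap ℂ Mikusinski.Q (((q : ℝ) : ℂ)⁻¹) * Mikusinski.s ∧
    Mikusinski.D (Mikusinski.ι Mikusinski.ContFun.l) = 1 ∧
    Mikusinski.IsDTField Mikusinski.Q Mikusinski.D (Mikusinski.tau q hq) ∧
    (∀ x : Mikusinski.Q, Mikusinski.D (Mikusinski.tau q hq x) =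
      algebraMap ℂ Mikusinski.Q ((q : ℝ) : ℂ) * Mikusinski.tau q hq (Mikusinski.D x)) ∧
    (∀ x : Mikusinski.Q,
      Mikusinski.ι Mikusinski.ContFun.l * Mikusinski.D (Mikusinski.tau q hq x) =
        Mikusinski.tau q hq (Mikusinski.ι Mikusinski.ContFun.l * Mikusinski.D x)) := by
  refine ⟨Mikusinski.tau_ι q hq, Mikusinski.tau_bijective q hq, Mikusinski.tau_algebraMap q hq,
    Mikusinski.tau_l q hq, Mikusinski.tau_s q hq, Mikusinski.D_l, Mikusinski.isDTField q hq,
    Mikusinski.D_tau q hq, fun x => ?_⟩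
  -- The factor `q` from `D τ_q = q τ_q D` is the one in `τ_q l = q l`.
  rw [map_mul, Mikusinski.tau_l, Mikusinski.D_tau]
  ring
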